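/- Let $\Gamma$ be a finite 3-valent graph (multiple edges and loops allowed) with vertex set $V$ and edge set $E$, of thickness 3: the minimal number of edges whose removal makes $\Gamma$ disconnected is 3. Let $g=|E|-|V|+1$ be its genus. Let $P_\Gamma$ be the large limit curve of $\Gamma$: the nodal curve obtained from copies $P_v=\mathbb{CP}^1$, $v\in V$, each with three distinct marked points labelled by the half-edges of the star of $v$, by identifying, for every edge, the two marked points that correspond to its two halves. A section of the canonical class $K_\Gamma$ is a family $(\omega_v)_{v\in V}$ of meromorphic differentials on the $P_v$ which are holomorphic outside the marked points, have at most simple poles at the marked points, and have opposite residues at the two marked points of every edge. Then $\dim H^0(P_\Gamma,K_\Gamma)=g$; the linear system $|K_\Gamma|$ has no base points, so that every basis $b_1,\dots,b_g$ of $H^0(P_\Gamma,K_\Gamma)$ defines a canonical map $\phi_{K_\Gamma}=[b_1:\dots:b_g]\colon P_\Gamma\to\mathbb P^{g-1}$; and the linear system $|2h-\phi_{K_\Gamma}(P_\Gamma)|$ of quadrics in $\mathbb P^{g-1}$ that contain the canonical curve $\phi_{K_\Gamma}(P_\Gamma)$ has dimension $$\dim|2h-\phi_{K_\Gamma}(P_\Gamma)|=\dim|2h|-3g+3,$$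 where $|2h|$ is the complete linear system of quadrics of $\mathbb P^{g-1}$, the dimension of a linear system is that of the projective space, and an empty linear system has dimension $-1$. Equivalently, the canonical curve imposes exactly $3g-3$ independent linear conditions on quadrics: the quadratic forms in $g$ variables that vanish on it form a subspace of codimension $3g-3$. -/

import Mathlib

noncomputable section

namespace LargeLimit

/-! ### Graphs -/

/-- A multigraph, loops and multiple edges allowed.  Every edge `e` has two half-edges
`(e, true)` and `(e, false)`, and `endpt` says at which vertex a half-edge is attached. -/
structure MultiGraph (V E : Type*) where
  endpt : E × Bool → V

/-- The other half of the same edge. -/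
def flip {E : Type*} (h : E × Bool) : E × Bool := (h.1, !h.2)

namespace MultiGraph

variable {V E : Type*} (G : MultiGraph V E)

/-- Every star consists of exactly three half-edges (a loop contributes two). -/
def IsTrivalent : Prop := ∀ v : V, Nat.card {h : E × Bool // G.endpt h = v} = 3

/-- The adjacency relation that is left after removing the edges in `S`. -/
def deleteEdges (S : Set E) : SimpleGraph V where
  Adj v w := v ≠ w ∧ ∃ h : E × Bool, h.1 ∉ S ∧ G.endpt h = v ∧ G.endpt (flip h) = w
  symm := ⟨by
    rintro v w ⟨hne, h, hS, hv, hw⟩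
    exact ⟨hne.symm, flip h, hS, hw, by simpa [flip] using hv⟩⟩
  loopless := ⟨fun _ h => h.1 rfl⟩

/-- The thickness: the minimal number of edges whose removal makes the graph disconnected. -/
def thickness : ℕ∞ := ⨅ S : {S : Set E // ¬ (G.deleteEdges S).Connected}, S.1.encard

/-- The genus (first Betti number) `|E| - |V| + 1` of a connected finite graph;
there `|V| ≤ |E| + 1`, so that the subtraction is not truncated. -/
def genus (_ : MultiGraph V E) : ℕ := Nat.card E + 1 - Nat.card V

end MultiGraph

/-! ### Rational differentials on the Riemann sphere -/

/-- The coordinate `z` of the Riemann sphere `OnePoint ℂ` written through the standard local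
parameter `t` at the point `x`: `z = a + t` at a finite point `a`, and `z = 1 / t` at infinity. -/
def coordAt : OnePoint ℂ → LaurentSeries ℂ
  | OnePoint.some a => HahnSeries.C a + HahnSeries.single 1 1
  | OnePoint.infty => HahnSeries.single (-1) 1

theorem coordAt_ne_C (x : OnePoint ℂ) (c : ℂ) : coordAt x ≠ HahnSeries.C c := by
  intro h
  induction x with
  | infty =>
    have := congrArg (fun f => HahnSeries.coeff f (-1)) h
    simp [coordAt, HahnSeries.C_apply, HahnSeries.coeff_single_of_ne] at this
  | coe a =>
    have := congrArg (fun f => HahnSeries.coeff f 1) h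
    simp [coordAt, HahnSeries.C_apply, HahnSeries.coeff_single_of_ne] at this

theorem eval₂_coordAt_ne_zero (x : OnePoint ℂ) (p : Polynomial ℂ) (hp : p ≠ 0) :
    Polynomial.eval₂ HahnSeries.C (coordAt x) p ≠ 0 := by
  intro h
  rw [Polynomial.eval₂_eq_eval_map] at h
  have hs : (p.map (HahnSeries.C : ℂ →+* LaurentSeries ℂ)).roots = p.roots.map HahnSeries.C :=
    (IsAlgClosed.splits p).roots_map _
  have hr : coordAt x ∈ (p.map (HahnSeries.C : ℂ →+* LaurentSeries ℂ)).roots :=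
    (Polynomial.mem_roots (Polynomial.map_ne_zero hp)).2 h
  rw [hs, Multiset.mem_map] at hr
  obtain ⟨c, -, hc⟩ := hr
  exact coordAt_ne_C x c hc.symm

/-- The Laurent expansion of a rational function of `z` at the point `x`: the homomorphism of
fields that is the identity on constants and sends `z` to `coordAt x`. -/
def expandAt (x : OnePoint ℂ) : RatFunc ℂ →+* LaurentSeries ℂ :=
  RatFunc.liftRingHom (Polynomial.eval₂RingHom HahnSeries.C (coordAt x)) fun p hp =>
    mem_nonZeroDivisors_of_ne_zero (eval₂_coordAt_ne_zero x p (nonZeroDivisors.ne_zero hp))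

theorem expandAt_algebraMap (x : OnePoint ℂ) (p : Polynomial ℂ) :
    expandAt x (algebraMap _ _ p) = Polynomial.eval₂ HahnSeries.C (coordAt x) p := by
  exact RatFunc.liftRingHom_algebraMap _ _ p

theorem expandAt_smul (x : OnePoint ℂ) (c : ℂ) (f : RatFunc ℂ) :
    expandAt x (c • f) = HahnSeries.C c * expandAt x f := by
  rw [RatFunc.smul_eq_C_mul, map_mul, ← RatFunc.algebraMap_C, expandAt_algebraMap,
    Polynomial.eval₂_C]

/-- The rational differential `f dz` on the Riemann sphere, expanded at `x` in the standard local
parameter `t`: the Laurent series `c(t) = f(z(t)) z'(t)` with `f dz = c(t) dt`. -/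
def differentialAt (x : OnePoint ℂ) : RatFunc ℂ →ₗ[ℂ] LaurentSeries ℂ where
  toFun f := expandAt x f * LaurentSeries.hasseDeriv ℂ 1 (coordAt x)
  map_add' f g := by rw [map_add, add_mul]
  map_smul' c f := by
    rw [expandAt_smul, mul_assoc, HahnSeries.C_mul_eq_smul, RingHom.id_apply]

/-! ### The large limit curve, its canonical sections and its canonical map -/

/-- The data of the large limit curve of `G`: on the Riemann sphere `P_v` of every vertex `v`,
a choice of pairwise distinct points, one for each half-edge in the star of `v`. -/
structure LargeLimitCurve {V E : Type*} (G : MultiGraph V E) where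
  pt : E × Bool → OnePoint ℂ
  pt_injOn : ∀ h h' : E × Bool, G.endpt h = G.endpt h' → pt h = pt h' → h = h'

namespace LargeLimitCurve

variable {V E : Type*} {G : MultiGraph V E} (P : LargeLimitCurve G)

/-- The gluing: the two marked points that belong to the two halves of an edge are identified. -/
def Glue (x y : V × OnePoint ℂ) : Prop :=
  ∃ h : E × Bool, x = (G.endpt h, P.pt h) ∧ y = (G.endpt (flip h), P.pt (flip h))

/-- The points of the large limit curve: the disjoint union of the spheres `P_v`,
glued along the edges. -/
def Points : Type _ := Quot P.Glue

/-- `x` is one of the marked points of `P_v`. -/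
def IsMarked (v : V) (x : OnePoint ℂ) : Prop := ∃ h : E × Bool, G.endpt h = v ∧ P.pt h = x

/-- The space of holomorphic sections of the canonical class: families of rational differentials
`ω v dz` on the spheres `P_v` that are holomorphic outside the marked points, have at most simple
poles at the marked points, and have opposite residues at the two marked points of each edge. -/
def canonicalSections : Submodule ℂ (V → RatFunc ℂ) where
  carrier := {ω |
    (∀ v x, ¬ P.IsMarked v x → ∀ n : ℤ, n < 0 → (differentialAt x (ω v)).coeff n = 0) ∧
    (∀ v x, P.IsMarked v x → ∀ n : ℤ, n < -1 → (differentialAt x (ω v)).coeff n = 0) ∧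
    (∀ e : E,
      (differentialAt (P.pt (e, true)) (ω (G.endpt (e, true)))).coeff (-1) +
      (differentialAt (P.pt (e, false)) (ω (G.endpt (e, false)))).coeff (-1) = 0)}
  zero_mem' := by simp
  add_mem' := by
    rintro ω η ⟨h1, h2, h3⟩ ⟨k1, k2, k3⟩
    refine ⟨fun v x hx n hn => ?_, fun v x hx n hn => ?_, fun e => ?_⟩
    · simp [h1 v x hx n hn, k1 v x hx n hn]
    · simp [h2 v x hx n hn, k2 v x hx n hn]
    · simp only [Pi.add_apply, map_add, HahnSeries.coeff_add]
      linear_combination h3 e + k3 e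
  smul_mem' := by
    rintro c ω ⟨h1, h2, h3⟩
    refine ⟨fun v x hx n hn => ?_, fun v x hx n hn => ?_, fun e => ?_⟩
    · simp [h1 v x hx n hn]
    · simp [h2 v x hx n hn]
    · simp only [Pi.smul_apply, map_smul, HahnSeries.coeff_smul, smul_eq_mul]
      linear_combination c * h3 e

open Classical in
/-- The value of a canonical section at the point `x` of `P_v`, in the trivialization of the fibre
of the canonical bundle that is given by `dt` at an unmarked point and by `dt / t` (that is, by the
residue) at a marked point. -/
def value (s : P.canonicalSections) (v : V) (x : OnePoint ℂ) : ℂ :=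
  (differentialAt x (s.1 v)).coeff (if P.IsMarked v x then -1 else 0)

/-- `φ` is the canonical map `x ↦ [b₀(x) : ⋯ : b_{g-1}(x)]` in the homogeneous coordinates given by
the basis `b` of the space of canonical sections; in particular no point of the curve is a common
zero of all canonical sections. -/
def IsCanonicalMap {g : ℕ} (b : Module.Basis (Fin g) ℂ P.canonicalSections)
    (φ : P.Points → Projectivization ℂ (Fin g → ℂ)) : Prop :=
  ∀ (v : V) (x : OnePoint ℂ), ∃ h : (fun i => P.value (b i) v x) ≠ 0,
    φ (Quot.mk _ (v, x)) = Projectivization.mk ℂ (fun i => P.value (b i) v x) h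

end LargeLimitCurve

/-! ### Linear systems of quadrics -/

/-- The quadratic forms on `ℂ^g`: the space whose projectivization is the complete linear
system `|2h|` on `P^{g-1}`. -/
abbrev quadrics (g : ℕ) : Submodule ℂ (MvPolynomial (Fin g) ℂ) :=
  MvPolynomial.homogeneousSubmodule (Fin g) ℂ 2

/-- The quadratic forms that vanish at every point of `X`: the space whose projectivization is
the linear system `|2h - X|` of quadrics through `X`. -/
def quadricsThrough {g : ℕ} (X : Set (Projectivization ℂ (Fin g → ℂ))) :
    Submodule ℂ (MvPolynomial (Fin g) ℂ) where
  carrier := {Q | Q ∈ quadrics g ∧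
    ∀ (u : Fin g → ℂ) (hu : u ≠ 0), Projectivization.mk ℂ u hu ∈ X → MvPolynomial.eval u Q = 0}
  zero_mem' := ⟨zero_mem _, by simp⟩
  add_mem' := by
    rintro Q R ⟨hQ, hQ'⟩ ⟨hR, hR'⟩
    exact ⟨add_mem hQ hR, fun u hu hX => by simp [hQ' u hu hX, hR' u hu hX]⟩
  smul_mem' := by
    rintro c Q ⟨hQ, hQ'⟩
    exact ⟨Submodule.smul_mem _ c hQ, fun u hu hX => by
      simp [MvPolynomial.smul_eval, hQ' u hu hX]⟩

/-- The dimension of the linear system `P(W)` of a (finite-dimensional) space of forms `W`, as a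
projective space; it is `-1` when the linear system is empty. -/
def projDim {M : Type*} [AddCommGroup M] [Module ℂ M] (W : Submodule ℂ M) : ℤ :=
  (Module.finrank ℂ W : ℤ) - 1

end LargeLimit

end

/-!
Taking residues at the marked points identifies the canonical sections with the flows on the graph:
a rational differential on the sphere with at most simple poles is determined by its residues, and
these can be prescribed subject to having sum zero (`LargeLimitCurve.sectionsEquivFlows`). The flows
are the kernel of the incidence matrix, whose rank for a connected graph is `|V| - 1`, so that they
form a space of dimension `|E| - |V| + 1`.

Each sphere is mapped to the span of the three nodes on it, whose coordinate vectors have sum zero.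
A quadratic form on the plane spanned by such a triple is zero as soon as it vanishes at the three
vectors; hence a quadric contains the canonical curve if and only if it contains all the nodes
(`LargeLimitCurve.eval_coords_eq_zero_iff`). The nodes correspond to the edges, and
`|E| = 3g - 3` because the graph is trivalent.

It remains to see that the nodes impose independent conditions on quadrics. The thickness enters
here: by the two-path case of Menger's theorem the ends of an edge `e` are joined by two
edge-disjoint paths that avoid `e`, and closing them up by `e` gives two circulations whose
supports meet in `e` only (`MultiGraph.exists_circulations_meeting_once`). A flow is a section,
that is, a linear form on the projective space whose value at a node is the flow through the edge;
the product of the two linear forms is a quadric that contains every node except the one of `e`.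
The same circulations show that there are no base points: at an unmarked point of a sphere the
values of the differentials `dz / (z - p)`, `p` marked, are distinct, so that a flow through two
of the three half-edges has nonzero value there.
-/

namespace LargeLimit

/-! ### Flows and cuts -/

@[simp] theorem flip_flip {E : Type*} (h : E × Bool) : flip (flip h) = h := by simp [flip]

@[simp] theorem flip_fst {E : Type*} (h : E × Bool) : (flip h).1 = h.1 := rfl

theorem flip_ne {E : Type*} (h : E × Bool) : flip h ≠ h := by
  intro hh
  simpa [flip] using congrArg Prod.snd hh

theorem eq_or_eq_flip {E : Type*} {h k : E × Bool} (hk : h.1 = k.1) : h = k ∨ h = flip k := by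
  obtain ⟨e, b⟩ := h
  obtain ⟨e', b'⟩ := k
  obtain rfl : e = e' := hk
  cases b <;> cases b' <;> simp [flip]

/-- Flipping as a permutation of the half-edges. -/
def flipEquiv (E : Type*) : Equiv.Perm (E × Bool) where
  toFun := flip
  invFun := flip
  left_inv := flip_flip
  right_inv := flip_flip

/-- The elementary flow that sends one unit through the half-edge `h` towards the other end of
its edge. -/
def unitAlong {E : Type*} [DecidableEq E] (h : E × Bool) (k : E × Bool) : ℤ :=
  (if k = h then 1 else 0) - if k = flip h then 1 else 0

theorem unitAlong_flip {E : Type*} [DecidableEq E] (h k : E × Bool) :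
    unitAlong h (flip k) = -unitAlong h k := by
  have h1 : (flip k = h) ↔ (k = flip h) :=
    ⟨fun hk => by rw [← hk, flip_flip], fun hk => by rw [hk, flip_flip]⟩
  have h2 : (flip k = flip h) ↔ (k = h) := (flipEquiv E).injective.eq_iff
  simp [unitAlong, h1, h2]

theorem unitAlong_self {E : Type*} [DecidableEq E] (h : E × Bool) : unitAlong h h = 1 := by
  simp [unitAlong, (flip_ne h).symm]

theorem unitAlong_of_ne {E : Type*} [DecidableEq E] {h k : E × Bool} (hk : k.1 ≠ h.1) :
    unitAlong h k = 0 := by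
  have h1 : k ≠ h := fun hh => hk (by rw [hh])
  have h2 : k ≠ flip h := fun hh => hk (by rw [hh, flip_fst])
  simp [unitAlong, h1, h2]

theorem eq_of_unitAlong_pos {E : Type*} [DecidableEq E] {h k : E × Bool}
    (hk : 0 < unitAlong h k) : k = h := by
  by_contra hne
  unfold unitAlong at hk
  rw [if_neg hne] at hk
  split_ifs at hk <;> omega

namespace MultiGraph

theorem connected_of_thickness {V E : Type*} (G : MultiGraph V E) (hth : G.thickness = 3) :
    (G.deleteEdges ∅).Connected := by
  by_contra hcon
  have h1 : (3 : ℕ∞) ≤ (∅ : Set E).encard :=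
    hth ▸ iInf_le (fun S : {S : Set E // ¬ (G.deleteEdges S).Connected} => S.1.encard) ⟨_, hcon⟩
  simp at h1

variable {V E : Type*} [Fintype E] [DecidableEq V] (G : MultiGraph V E)

/-- The net amount that leaves the vertex `v` in the flow `q`. -/
def outflow {R : Type*} [AddCommMonoid R] (q : E × Bool → R) (v : V) : R :=
  ∑ h with G.endpt h = v, q h

theorem outflow_unitAlong [DecidableEq E] (h : E × Bool) (v : V) :
    G.outflow (unitAlong h) v =
      (if v = G.endpt h then 1 else 0) - if v = G.endpt (flip h) then 1 else 0 := by
  simp only [outflow, unitAlong, Finset.sum_sub_distrib, Finset.sum_ite_eq', Finset.mem_filter,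
    Finset.mem_univ, true_and, eq_comm (a := v)]

theorem outflow_add {R : Type*} [AddCommMonoid R] (p q : E × Bool → R) (v : V) :
    G.outflow (p + q) v = G.outflow p v + G.outflow q v := by
  simp [outflow, Finset.sum_add_distrib]

theorem outflow_sub (p q : E × Bool → ℤ) (v : V) :
    G.outflow (p - q) v = G.outflow p v - G.outflow q v := by
  simp [outflow, Finset.sum_sub_distrib]

/-- `q` is an integral flow of value one from `u` to `w` (for `u = w` a circulation) that only uses
half-edges in `R`, each at most once; `R` is a set of directed edges, a half-edge being directed
away from its endpoint. -/
structure IsUnitFlow (R : Set (E × Bool)) (u w : V) (q : E × Bool → ℤ) : Prop where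
  antisymm : ∀ h, q (flip h) = -q h
  le_one : ∀ h, q h ≤ 1
  mem : ∀ h, 0 < q h → h ∈ R
  outflow : ∀ x, G.outflow q x = (if x = u then 1 else 0) - if x = w then 1 else 0

/-- Either `w` can be reached from `u` by a unit flow through `R`, or some set of vertices that
contains `u` but not `w` is closed under the half-edges in `R`. -/
theorem exists_isUnitFlow_or_cut [Finite V] (R : Set (E × Bool)) (u w : V) :
    (∃ q, G.IsUnitFlow R u w q) ∨
      ∃ S : Finset V, u ∈ S ∧ w ∉ S ∧ ∀ h ∈ R, G.endpt h ∈ S → G.endpt (flip h) ∈ S := by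
  classical
  -- `S` is a maximal set of vertices that can be reached without leaving `S`.
  let good : Finset V → Prop := fun S => u ∈ S ∧
    ∀ x ∈ S, ∃ q, G.IsUnitFlow R u x q ∧
      ∀ h, 0 < q h → G.endpt h ∈ S ∧ G.endpt (flip h) ∈ S
  have hne : {S : Finset V | good S}.Nonempty := by
    refine ⟨{u}, Finset.mem_singleton_self u, fun x hx => ?_⟩
    obtain rfl := Finset.mem_singleton.1 hx
    exact ⟨0, ⟨by simp, by simp, by simp, by simp [MultiGraph.outflow]⟩, by simp⟩
  obtain ⟨S, hS⟩ := (Set.toFinite {S : Finset V | good S}).exists_maximal hne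
  obtain ⟨⟨huS, hflow⟩, hmax⟩ := hS
  by_cases hw : w ∈ S
  · obtain ⟨q, hq, -⟩ := hflow w hw
    exact Or.inl ⟨q, hq⟩
  refine Or.inr ⟨S, huS, hw, fun h hR hh => ?_⟩
  by_contra hout
  refine hout (hmax (y := insert (G.endpt (flip h)) S) ?_ (Finset.subset_insert _ _)
    (Finset.mem_insert_self _ _))
  refine ⟨Finset.mem_insert_of_mem huS, fun x hx => ?_⟩
  rcases Finset.mem_insert.1 hx with rfl | hx
  · obtain ⟨q, hq, hqS⟩ := hflow _ hh
    have hzero : ∀ k, k.1 = h.1 → q k ≤ 0 := by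
      intro k hk
      by_contra hpos
      have := hqS k (not_le.1 hpos)
      rcases eq_or_eq_flip hk with rfl | rfl
      · exact hout this.2
      · exact hout this.1
    have hpos : ∀ k, 0 < (q + unitAlong h) k → 0 < q k ∨ k = h := by
      intro k hk
      by_contra! hcon
      have h1 : ¬ 0 < unitAlong h k := fun h2 => hcon.2 (eq_of_unitAlong_pos h2)
      simp only [Pi.add_apply] at hk
      omega
    refine ⟨q + unitAlong h, ⟨fun k => ?_, fun k => ?_, fun k hk => ?_, fun x => ?_⟩,
      fun k hk => ?_⟩
    · simp only [Pi.add_apply, hq.antisymm, unitAlong_flip]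
      ring
    · by_cases hk : k.1 = h.1
      · have h1 := hzero k hk
        have h2 : unitAlong h k ≤ 1 := by unfold unitAlong; split_ifs <;> omega
        simp only [Pi.add_apply]
        omega
      · simpa [unitAlong_of_ne hk] using hq.le_one k
    · rcases hpos k hk with hk | rfl
      · exact hq.mem k hk
      · exact hR
    · rw [outflow_add, hq.outflow, outflow_unitAlong]
      ring
    · rcases hpos k hk with hk | rfl
      · exact ⟨Finset.mem_insert_of_mem (hqS k hk).1, Finset.mem_insert_of_mem (hqS k hk).2⟩
      · exact ⟨Finset.mem_insert_of_mem hh, Finset.mem_insert_self _ _⟩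
  · obtain ⟨q, hq, hqS⟩ := hflow x hx
    exact ⟨q, hq, fun k hk =>
      ⟨Finset.mem_insert_of_mem (hqS k hk).1, Finset.mem_insert_of_mem (hqS k hk).2⟩⟩

/-- The half-edges through which one leaves the set of vertices `S`. -/
def leaving (S : Finset V) : Finset (E × Bool) :=
  {h | G.endpt h ∈ S ∧ G.endpt (flip h) ∉ S}

theorem mem_leaving {S : Finset V} {h : E × Bool} :
    h ∈ G.leaving S ↔ G.endpt h ∈ S ∧ G.endpt (flip h) ∉ S := by
  simp [leaving]

theorem injOn_fst_leaving (S : Finset V) : Set.InjOn Prod.fst (G.leaving S : Set (E × Bool)) := by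
  intro h hh k hk hhk
  rw [Finset.mem_coe, mem_leaving] at hh hk
  rcases eq_or_eq_flip hhk with rfl | rfl
  · rfl
  · exact absurd hh.1 hk.2

theorem sum_outflow (q : E × Bool → ℤ) (hq : ∀ h, q (flip h) = -q h) (S : Finset V) :
    ∑ v ∈ S, G.outflow q v = ∑ h ∈ G.leaving S, q h := by
  classical
  have h1 : ∑ v ∈ S, G.outflow q v = ∑ h with G.endpt h ∈ S, q h := by
    rw [← Finset.sum_fiberwise_of_maps_to (s := ({h | G.endpt h ∈ S} : Finset (E × Bool)))
      (t := S) (g := G.endpt) (by simp)]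
    refine Finset.sum_congr rfl fun v hv => Finset.sum_congr ?_ fun _ _ => rfl
    ext h
    simp only [Finset.mem_filter, Finset.mem_univ, true_and]
    exact ⟨fun h => ⟨h ▸ hv, h⟩, fun h => h.2⟩
  rw [h1, ← Finset.sum_filter_add_sum_filter_not _ (fun h => G.endpt (flip h) ∈ S)]
  have h2 : ∑ h ∈ ({h | G.endpt h ∈ S} : Finset (E × Bool)) with G.endpt (flip h) ∈ S, q h = 0 := by
    refine Finset.sum_involution (fun h _ => flip h) (fun h _ => by rw [hq]; ring)
      (fun h _ _ => flip_ne h) (fun h hh => ?_) (fun h _ => flip_flip h)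
    simp only [Finset.mem_filter, Finset.mem_univ, true_and, flip_flip] at hh ⊢
    exact hh.symm
  rw [h2, zero_add]
  refine Finset.sum_congr ?_ fun _ _ => rfl
  ext h
  simp [leaving]

/-- The outflow of a unit flow summed over a set that contains its source but not its sink. -/
theorem IsUnitFlow.sum_leaving {R : Set (E × Bool)} {u w : V} {q : E × Bool → ℤ}
    (hq : G.IsUnitFlow R u w q) {S : Finset V} (hu : u ∈ S) (hw : w ∉ S) :
    ∑ h ∈ G.leaving S, q h = 1 := by
  rw [← G.sum_outflow q hq.antisymm, Finset.sum_congr rfl fun v _ => hq.outflow v]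
  simp [Finset.sum_sub_distrib, hu, hw]

theorem IsUnitFlow.eq_zero {R : Set (E × Bool)} {u w : V} {q : E × Bool → ℤ}
    (hq : G.IsUnitFlow R u w q) {h : E × Bool} (h1 : h ∉ R) (h2 : flip h ∉ R) : q h = 0 := by
  have h3 : ¬ 0 < q h := fun h4 => h1 (hq.mem h h4)
  have h4 : ¬ 0 < q (flip h) := fun h5 => h2 (hq.mem _ h5)
  rw [hq.antisymm] at h4
  omega

/-- In a graph of thickness three at least three edges leave every nonempty proper set of
vertices. -/
theorem three_le_card_leaving (hth : G.thickness = 3) {S : Finset V} {u w : V} (hu : u ∈ S)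
    (hw : w ∉ S) : 3 ≤ (G.leaving S).card := by
  classical
  have hdis : ¬ (G.deleteEdges (Prod.fst '' (G.leaving S : Set (E × Bool)))).Connected := by
    intro hc
    obtain ⟨p⟩ := hc.preconnected u w
    obtain ⟨d, hd, hd1, hd2⟩ := p.exists_boundary_dart (S : Set V) hu hw
    obtain ⟨hne, h, hh, h1, h2⟩ := d.adj
    refine hh ⟨h, ?_, rfl⟩
    rw [Finset.mem_coe, mem_leaving, h1, h2]
    exact ⟨hd1, hd2⟩
  have h1 : (3 : ℕ∞) ≤ (Prod.fst '' (G.leaving S : Set (E × Bool))).encard :=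
    hth ▸ iInf_le (fun S : {S : Set E // ¬ (G.deleteEdges S).Connected} => S.1.encard) ⟨_, hdis⟩
  rw [(G.injOn_fst_leaving S).encard_image, Set.encard_coe_eq_coe_finsetCard] at h1
  exact_mod_cast h1

theorem card_leaving_filter_le [DecidableEq E] (S : Finset V) (e : E) :
    ((G.leaving S).filter (fun h => h.1 = e)).card ≤ 1 := by
  refine Finset.card_le_one.2 fun h hh k hk => ?_
  simp only [Finset.mem_filter] at hh hk
  exact G.injOn_fst_leaving S hh.1 hk.1 (hh.2.trans hk.2.symm)

/-- The case of two paths of Menger's theorem, by augmentation of flows: in a graph of thickness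
three, any two vertices are joined by two edge-disjoint flows that avoid a given edge `e`. -/
theorem exists_disjoint_unitFlows [Finite V] (hth : G.thickness = 3) (e : E) (u w : V) :
    ∃ a b : E × Bool → ℤ, G.IsUnitFlow {h | h.1 ≠ e} u w a ∧
      (∀ h, b (flip h) = -b h) ∧ (∀ h, h.1 = e → b h = 0) ∧
      (∀ x, G.outflow b x = (if x = u then 1 else 0) - if x = w then 1 else 0) ∧
      ∀ h, a h * b h = 0 := by
  classical
  have hsplit (S : Finset V) := Finset.card_filter_add_card_filter_not
    (s := G.leaving S) (fun h => h.1 = e)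
  obtain ⟨p, hp⟩ : ∃ p, G.IsUnitFlow {h | h.1 ≠ e} u w p := by
    refine (G.exists_isUnitFlow_or_cut _ u w).resolve_right ?_
    rintro ⟨S, hu, hw, hS⟩
    have h1 := G.three_le_card_leaving hth hu hw
    have h2 := G.card_leaving_filter_le S e
    have h3 : (G.leaving S).filter (fun h => ¬ h.1 = e) = ∅ := by
      refine Finset.filter_eq_empty_iff.2 fun h hh hne => ?_
      rw [mem_leaving] at hh
      exact hh.2 (hS h hne hh.1)
    have h4 := hsplit S
    rw [h3, Finset.card_empty] at h4
    omega
  have hpe : ∀ h, h.1 = e → p h = 0 := fun h hh => hp.eq_zero G (by simp [hh]) (by simp [hh])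
  -- The second flow is found in the residual graph of `p`.
  obtain ⟨q, hq⟩ : ∃ q, G.IsUnitFlow {h | h.1 ≠ e ∧ p h ≤ 0} u w q := by
    refine (G.exists_isUnitFlow_or_cut _ u w).resolve_right ?_
    rintro ⟨S, hu, hw, hS⟩
    have h1 := G.three_le_card_leaving hth hu hw
    have h2 := G.card_leaving_filter_le S e
    have h4 := hsplit S
    have h5 := hp.sum_leaving G hu hw
    rw [← Finset.sum_filter_add_sum_filter_not _ (fun h => h.1 = e),
      Finset.sum_eq_zero fun h hh => hpe h (Finset.mem_filter.1 hh).2, zero_add,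
      Finset.sum_congr rfl (g := fun _ => (1 : ℤ)) fun h hh => ?_] at h5
    · simp at h5
      omega
    · rw [Finset.mem_filter, mem_leaving] at hh
      have h6 : ¬ p h ≤ 0 := fun h7 => hh.1.2 (hS h ⟨hh.2, h7⟩ hh.1.1)
      have h7 := hp.le_one h
      omega
  have hqe : ∀ h, h.1 = e → q h = 0 := fun h hh => hq.eq_zero G (by simp [hh]) (by simp [hh])
  have hf1 : ∀ h, p h + q h ≤ 1 := by
    intro h
    by_contra hcon
    have h1 := hp.le_one h
    have h2 := hq.le_one h
    have h3 := (hq.mem h (by omega)).2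
    omega
  have hfS : ∀ S : Finset V, u ∈ S → w ∉ S → ∑ h ∈ G.leaving S, (p h + q h) = 2 := by
    intro S hu hw
    rw [Finset.sum_add_distrib, hp.sum_leaving G hu hw, hq.sum_leaving G hu hw]
    rfl
  -- The sum `p + q` of value two is split by a unit flow `a` inside its support.
  obtain ⟨a, ha⟩ : ∃ a, G.IsUnitFlow {h | 0 < p h + q h} u w a := by
    refine (G.exists_isUnitFlow_or_cut _ u w).resolve_right ?_
    rintro ⟨S, hu, hw, hS⟩
    have h1 := hfS S hu hw
    have h2 : ∑ h ∈ G.leaving S, (p h + q h) ≤ 0 := by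
      refine Finset.sum_nonpos fun h hh => ?_
      rw [mem_leaving] at hh
      by_contra hcon
      exact hh.2 (hS h (not_le.1 hcon) hh.1)
    omega
  have hae : ∀ h, 0 < a h → h.1 ≠ e := by
    intro h hh he
    have := ha.mem h hh
    simp [hpe h he, hqe h he] at this
  refine ⟨a, p + q - a, ⟨ha.antisymm, ha.le_one, hae, ha.outflow⟩, fun h => ?_, fun h he => ?_,
    fun x => ?_, fun h => ?_⟩
  · simp only [Pi.sub_apply, Pi.add_apply, hp.antisymm, hq.antisymm, ha.antisymm]
    ring
  · have h1 : ¬ 0 < a h := fun h2 => hae h h2 he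
    have h2 : ¬ 0 < a (flip h) := fun h2 => hae _ h2 he
    rw [ha.antisymm] at h2
    simp only [Pi.sub_apply, Pi.add_apply, hpe h he, hqe h he]
    omega
  · rw [outflow_sub, outflow_add, hp.outflow, hq.outflow, ha.outflow]
    ring
  · have key : ∀ h, 0 < a h → a h = p h + q h := by
      intro h hh
      have h1 := ha.mem h hh
      have h2 := hf1 h
      have h3 := ha.le_one h
      simp only [Set.mem_ofPred_eq] at h1
      omega
    rcases lt_trichotomy (a h) 0 with h1 | h1 | h1
    · have h2 := key (flip h) (by rw [ha.antisymm]; omega)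
      rw [ha.antisymm, hp.antisymm, hq.antisymm] at h2
      have h3 : (p + q - a) h = 0 := by
        simp only [Pi.sub_apply, Pi.add_apply]
        omega
      rw [h3, mul_zero]
    · rw [h1, zero_mul]
    · have h3 : (p + q - a) h = 0 := by
        simp only [Pi.sub_apply, Pi.add_apply, key h h1]
        omega
      rw [h3, mul_zero]

/-- Two circulations through the edge of `k` whose supports have no other edge in common. -/
theorem exists_circulations_meeting_once [Finite V] (hth : G.thickness = 3) (k : E × Bool) :
    ∃ a b : E × Bool → ℤ, (∀ h, a (flip h) = -a h) ∧ (∀ h, b (flip h) = -b h) ∧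
      (∀ x, G.outflow a x = 0) ∧ (∀ x, G.outflow b x = 0) ∧ a k = 1 ∧ b k = 1 ∧
      ∀ h, h.1 ≠ k.1 → a h * b h = 0 := by
  classical
  obtain ⟨a, b, ha, hb, hbe, hbo, hab⟩ :=
    G.exists_disjoint_unitFlows hth k.1 (G.endpt (flip k)) (G.endpt k)
  have hak : a k = 0 := ha.eq_zero G (by simp) (by simp)
  refine ⟨a + unitAlong k, b + unitAlong k, fun h => ?_, fun h => ?_, fun x => ?_, fun x => ?_,
    ?_, ?_, fun h hh => ?_⟩
  · simp only [Pi.add_apply, ha.antisymm, unitAlong_flip]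
    ring
  · simp only [Pi.add_apply, hb, unitAlong_flip]
    ring
  · rw [outflow_add, ha.outflow, outflow_unitAlong]
    ring
  · rw [outflow_add, hbo, outflow_unitAlong]
    ring
  · simp [hak, unitAlong_self]
  · simp [hbe k rfl, unitAlong_self]
  · simp [unitAlong_of_ne hh, hab h]

end MultiGraph

/-! ### The space of flows -/

namespace MultiGraph

variable {V E : Type*} [Fintype E] [DecidableEq V] (G : MultiGraph V E)

/-- The complex flows, the first homology of the graph: antisymmetric functions on the half-edges
with sum zero over every star. -/
def flows : Submodule ℂ (E × Bool → ℂ) where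
  carrier := {r | (∀ h, r (flip h) = -r h) ∧ ∀ v, G.outflow r v = 0}
  zero_mem' := by simp [outflow]
  add_mem' := by
    rintro r s ⟨h1, h2⟩ ⟨k1, k2⟩
    exact ⟨fun h => by simp [h1, k1, add_comm], fun v => by rw [outflow_add, h2, k2, add_zero]⟩
  smul_mem' := by
    rintro c r ⟨h1, h2⟩
    refine ⟨fun h => by simp [h1], fun v => ?_⟩
    have := h2 v
    simp only [outflow] at this ⊢
    simp [← Finset.mul_sum, this]

theorem intCast_mem_flows {a : E × Bool → ℤ} (ha : ∀ h, a (flip h) = -a h)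
    (hd : ∀ x, G.outflow a x = 0) : (fun h => (a h : ℂ)) ∈ G.flows := by
  refine ⟨fun h => by simp [ha], fun v => ?_⟩
  have := hd v
  simp only [outflow] at this ⊢
  exact_mod_cast this

/-- The incidence matrix of `G`, every edge oriented from its half `true` to its half `false`. -/
def incidence : Matrix V E ℂ := fun v e =>
  (if G.endpt (e, true) = v then 1 else 0) - if G.endpt (e, false) = v then 1 else 0

theorem outflow_eq_incidence_mulVec {r : E × Bool → ℂ} (hr : ∀ h, r (flip h) = -r h) (v : V) :
    G.outflow r v = (G.incidence.mulVec fun e => r (e, true)) v := by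
  have h1 : ∀ e, r (e, false) = -r (e, true) := fun e => hr (e, true)
  simp only [outflow, Finset.sum_filter, Fintype.sum_prod_type, Fintype.sum_bool,
    Matrix.mulVec, dotProduct, incidence, h1]
  refine Finset.sum_congr rfl fun e _ => ?_
  split_ifs <;> simp

/-- A flow is determined by its values on one half of every edge, which form an arbitrary vector
in the kernel of the incidence matrix. -/
def flowsEquivKer : G.flows ≃ₗ[ℂ] LinearMap.ker G.incidence.mulVecLin where
  toFun r := ⟨fun e => r.1 (e, true), by
    rw [LinearMap.mem_ker]
    ext v
    rw [Matrix.mulVecLin_apply, ← G.outflow_eq_incidence_mulVec r.2.1, r.2.2]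
    rfl⟩
  map_add' _ _ := rfl
  map_smul' _ _ := rfl
  invFun y := ⟨fun h => if h.2 then y.1 h.1 else -y.1 h.1, by
    have h1 : ∀ h : E × Bool, (if (flip h).2 then y.1 (flip h).1 else -y.1 (flip h).1) =
        -(if h.2 then y.1 h.1 else -y.1 h.1) := by
      rintro ⟨e, b⟩
      cases b <;> simp [flip]
    refine ⟨h1, fun v => ?_⟩
    rw [G.outflow_eq_incidence_mulVec h1]
    exact congrFun (LinearMap.mem_ker.1 y.2) v⟩
  left_inv r := by
    ext ⟨e, b⟩
    cases b
    · simpa [flip] using (r.2.1 (e, true)).symm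
    · simp
  right_inv y := by
    ext e
    simp

theorem finrank_ker_incidence_transpose {V E : Type*} [DecidableEq V] [Fintype V]
    (G : MultiGraph V E) (hc : (G.deleteEdges ∅).Connected) :
    Module.finrank ℂ (LinearMap.ker G.incidence.transpose.mulVecLin) = 1 := by
  have hker : ∀ p, p ∈ LinearMap.ker G.incidence.transpose.mulVecLin ↔
      ∀ e, p (G.endpt (e, true)) = p (G.endpt (e, false)) := by
    intro p
    rw [LinearMap.mem_ker, funext_iff]
    refine forall_congr' fun e => ?_
    simp [Matrix.vecMul, dotProduct, incidence, mul_sub, sub_eq_zero]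
  obtain ⟨v₀⟩ := hc.nonempty
  have hone : (1 : V → ℂ) ∈ LinearMap.ker G.incidence.transpose.mulVecLin := by
    rw [hker]
    simp
  refine finrank_eq_one (⟨1, hone⟩ : LinearMap.ker G.incidence.transpose.mulVecLin) ?_ ?_
  · intro h
    exact one_ne_zero (congrFun (congrArg Subtype.val h) v₀)
  · rintro ⟨p, hp⟩
    rw [hker] at hp
    have hadj : ∀ v w, (G.deleteEdges ∅).Adj v w → p v = p w := by
      rintro v w ⟨-, ⟨e, b⟩, -, rfl, rfl⟩
      cases b
      · exact (hp e).symm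
      · exact hp e
    refine ⟨p v₀, Subtype.ext (funext fun v => ?_)⟩
    obtain ⟨q⟩ := hc.preconnected v₀ v
    have : p v₀ = p v := by
      induction q with
      | nil => rfl
      | cons h _ ih => exact (hadj _ _ h).trans ih
    simpa using this

/-- The space of flows of a connected graph has dimension `|E| - |V| + 1`. -/
theorem finrank_flows_add_card [Fintype V] (hc : (G.deleteEdges ∅).Connected) :
    Module.finrank ℂ G.flows + Fintype.card V = Fintype.card E + 1 := by
  have h1 := G.incidence.mulVecLin.finrank_range_add_finrank_ker
  have h2 := G.incidence.transpose.mulVecLin.finrank_range_add_finrank_ker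
  have h3 := G.incidence.rank_transpose
  rw [Matrix.rank, Matrix.rank] at h3
  rw [Module.finrank_fintype_fun_eq_card] at h1 h2
  rw [G.finrank_ker_incidence_transpose hc] at h2
  rw [G.flowsEquivKer.finrank_eq]
  omega

/-- Counting half-edges in a trivalent graph. -/
theorem IsTrivalent.two_mul_card_edges {G : MultiGraph V E} [Fintype V] (hG : G.IsTrivalent) :
    2 * Fintype.card E = 3 * Fintype.card V := by
  have h1 : Fintype.card (E × Bool) = ∑ v : V, 3 := by
    rw [← Finset.card_univ, Finset.card_eq_sum_card_fiberwise (f := G.endpt) (t := Finset.univ)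
      (by simp)]
    refine Finset.sum_congr rfl fun v _ => ?_
    rw [← hG v, Nat.card_eq_fintype_card, Fintype.card_subtype]
  simp only [Fintype.card_prod, Fintype.card_bool, Finset.sum_const, Finset.card_univ,
    smul_eq_mul] at h1
  omega

theorem IsTrivalent.exists_star {G : MultiGraph V E} (hG : G.IsTrivalent) (v : V) :
    ∃ h₁ h₂ h₃, G.endpt h₁ = v ∧ G.endpt h₂ = v ∧ G.endpt h₃ = v ∧ h₁ ≠ h₂ ∧ h₁ ≠ h₃ ∧ h₂ ≠ h₃ ∧
      ∀ {M : Type} [AddCommMonoid M] (f : E × Bool → M),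
        ∑ h with G.endpt h = v, f h = f h₁ + f h₂ + f h₃ := by
  classical
  have h1 : ({h | G.endpt h = v} : Finset (E × Bool)).card = 3 := by
    rw [← hG v, Nat.card_eq_fintype_card, Fintype.card_subtype]
  obtain ⟨h₁, h₂, h₃, h₁₂, h₁₃, h₂₃, hs⟩ := Finset.card_eq_three.1 h1
  have hmem : ∀ h, G.endpt h = v ↔ h = h₁ ∨ h = h₂ ∨ h = h₃ := by
    intro h
    simpa using congrArg (h ∈ ·) hs
  refine ⟨h₁, h₂, h₃, (hmem _).2 (by simp), (hmem _).2 (by simp), (hmem _).2 (by simp),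
    h₁₂, h₁₃, h₂₃, fun f => ?_⟩
  rw [hs, Finset.sum_insert (by simp [h₁₂, h₁₃]), Finset.sum_insert (by simp [h₂₃]),
    Finset.sum_singleton, add_assoc]

end MultiGraph

/-! ### Expansions of differentials with simple poles -/

theorem coordAt_coe (a : ℂ) :
    coordAt (a : OnePoint ℂ) = HahnSeries.C a + HahnSeries.single 1 1 := rfl

theorem coordAt_infty : coordAt OnePoint.infty = HahnSeries.single (-1) 1 := rfl

theorem hasseDeriv_coordAt_coe (a : ℂ) :
    LaurentSeries.hasseDeriv ℂ 1 (coordAt (a : OnePoint ℂ)) = 1 := by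
  ext n
  rw [LaurentSeries.hasseDeriv_coeff, coordAt_coe, HahnSeries.coeff_add, HahnSeries.C_apply,
    HahnSeries.coeff_one]
  by_cases hn : n = 0
  · simp [hn]
  · by_cases hn1 : n = -1
    · simp [hn1]
    · have h1 : n + 1 ≠ 0 := by omega
      simp [hn, h1]

theorem hasseDeriv_coordAt_infty :
    LaurentSeries.hasseDeriv ℂ 1 (coordAt OnePoint.infty) = HahnSeries.single (-2) (-1) := by
  ext n
  rw [LaurentSeries.hasseDeriv_coeff, coordAt_infty]
  by_cases hn : n = -2
  · simp [hn]
  · have h1 : n + 1 ≠ -1 := by omega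
    simp [hn, h1]

theorem differentialAt_coe (a : ℂ) (f : RatFunc ℂ) :
    differentialAt (a : OnePoint ℂ) f = expandAt a f := by
  change expandAt a f * LaurentSeries.hasseDeriv ℂ 1 (coordAt (a : OnePoint ℂ)) = _
  rw [hasseDeriv_coordAt_coe, mul_one]

theorem differentialAt_infty (f : RatFunc ℂ) :
    differentialAt OnePoint.infty f = expandAt OnePoint.infty f * HahnSeries.single (-2) (-1) := by
  change expandAt _ f * LaurentSeries.hasseDeriv ℂ 1 (coordAt OnePoint.infty) = _
  rw [hasseDeriv_coordAt_infty]

theorem coeff_differentialAt_infty (f : RatFunc ℂ) (n : ℤ) :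
    (differentialAt OnePoint.infty f).coeff n = -(expandAt OnePoint.infty f).coeff (n + 2) := by
  rw [differentialAt_infty]
  have := HahnSeries.coeff_mul_single_add (r := (-1 : ℂ)) (x := expandAt OnePoint.infty f)
    (a := n + 2) (b := -2)
  rw [add_neg_cancel_right, mul_neg_one] at this
  rw [this]

theorem coeff_ofPowerSeries_of_neg (p : PowerSeries ℂ) {n : ℤ} (hn : n < 0) :
    (HahnSeries.ofPowerSeries ℤ ℂ p).coeff n = 0 := by
  rw [PowerSeries.coeff_coe, if_pos hn]

theorem coeff_zero_ofPowerSeries (p : PowerSeries ℂ) :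
    (HahnSeries.ofPowerSeries ℤ ℂ p).coeff 0 = PowerSeries.constantCoeff p := by
  simp [PowerSeries.coeff_coe]

theorem exists_eq_ofPowerSeries {y : LaurentSeries ℂ} (hy : ∀ n : ℤ, n < 0 → y.coeff n = 0) :
    ∃ p, y = HahnSeries.ofPowerSeries ℤ ℂ p := by
  refine ⟨PowerSeries.mk fun n => y.coeff n, ?_⟩
  ext n
  rw [PowerSeries.coeff_coe]
  split_ifs with hn
  · exact hy n hn
  · rw [PowerSeries.coeff_mk, Int.natAbs_of_nonneg (not_lt.1 hn)]

theorem expandAt_coe_algebraMap (a : ℂ) (p : Polynomial ℂ) :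
    expandAt (a : OnePoint ℂ) (algebraMap _ _ p) = HahnSeries.ofPowerSeries ℤ ℂ
      (p.eval₂ PowerSeries.C (PowerSeries.C a + PowerSeries.X)) := by
  rw [expandAt_algebraMap, Polynomial.hom_eval₂, map_add, PowerSeries.coe_C, PowerSeries.coe_X,
    coordAt_coe]
  congr 1
  ext1 c
  simp

theorem constantCoeff_eval₂ (a : ℂ) (p : Polynomial ℂ) :
    PowerSeries.constantCoeff (p.eval₂ PowerSeries.C (PowerSeries.C a + PowerSeries.X)) =
      p.eval a := by
  rw [Polynomial.hom_eval₂]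
  have : (PowerSeries.constantCoeff (R := ℂ)).comp PowerSeries.C = RingHom.id ℂ := by
    ext1 c
    simp
  simp [this, Polynomial.eval₂_id]

theorem coeff_expandAt_infty_algebraMap (p : Polynomial ℂ) :
    (expandAt OnePoint.infty (algebraMap _ _ p)).coeff (-(p.natDegree : ℤ)) = p.leadingCoeff := by
  have h1 : ∀ i ∈ Finset.range (p.natDegree + 1),
      (HahnSeries.C (p.coeff i) * (HahnSeries.single (-1 : ℤ) (1 : ℂ)) ^ i).coeff
        (-(p.natDegree : ℤ)) = if i = p.natDegree then p.leadingCoeff else 0 := by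
    intro i _
    rw [HahnSeries.C_mul_eq_smul, HahnSeries.coeff_smul, HahnSeries.single_pow]
    split_ifs with hi
    · simp [hi]
    · rw [HahnSeries.coeff_single_of_ne, smul_zero]
      simpa [eq_comm] using hi
  rw [expandAt_algebraMap, coordAt_infty, Polynomial.eval₂_eq_sum_range, HahnSeries.coeff_sum,
    Finset.sum_congr rfl h1]
  simp

/-- A rational differential with no finite poles that has at most a simple pole at infinity is
zero. -/
theorem eq_zero_of_differentialAt {f : RatFunc ℂ}
    (hfin : ∀ (a : ℂ) (n : ℤ), n < 0 → (differentialAt (a : OnePoint ℂ) f).coeff n = 0)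
    (hinf : ∀ n : ℤ, n < -1 → (differentialAt OnePoint.infty f).coeff n = 0) : f = 0 := by
  have hroot : ∀ a : ℂ, f.denom.eval a ≠ 0 := by
    intro a ha
    obtain ⟨y, hy⟩ := exists_eq_ofPowerSeries (y := expandAt (a : OnePoint ℂ) f)
      fun n hn => by rw [← differentialAt_coe]; exact hfin a n hn
    have hd : algebraMap (Polynomial ℂ) (RatFunc ℂ) f.denom ≠ 0 := by
      simpa using f.denom_ne_zero
    have h1 : f * algebraMap (Polynomial ℂ) (RatFunc ℂ) f.denom =
        algebraMap (Polynomial ℂ) (RatFunc ℂ) f.num := by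
      conv_lhs => rw [← f.num_div_denom]
      rw [RatFunc.num_div_denom, ← eq_div_iff hd, RatFunc.num_div_denom]
    have h2 := congrArg (expandAt (a : OnePoint ℂ)) h1
    rw [map_mul, hy, expandAt_coe_algebraMap, expandAt_coe_algebraMap, ← map_mul] at h2
    have h3 := congrArg PowerSeries.constantCoeff (HahnSeries.ofPowerSeries_injective h2)
    rw [map_mul, constantCoeff_eval₂, constantCoeff_eval₂, ha, mul_zero] at h3
    obtain ⟨s, t, hst⟩ := f.isCoprime_num_denom
    have h4 := congrArg (Polynomial.eval a) hst
    simp [← h3, ha] at h4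
  have hdeg : f.denom.degree = 0 := by
    by_contra hne
    obtain ⟨a, ha⟩ := IsAlgClosed.exists_root f.denom hne
    exact hroot a ha
  have hone : f.denom = 1 :=
    f.monic_denom.natDegree_eq_zero.1 (Polynomial.natDegree_eq_zero_iff_degree_le_zero.2 hdeg.le)
  have hf : f = algebraMap (Polynomial ℂ) (RatFunc ℂ) f.num := by
    conv_lhs => rw [← f.num_div_denom]
    rw [hone, map_one, div_one]
  have h1 := coeff_expandAt_infty_algebraMap f.num
  have h2 := hinf (-(f.num.natDegree : ℤ) - 2) (by omega)
  rw [coeff_differentialAt_infty, sub_add_cancel, neg_eq_zero, hf] at h2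
  rw [RatFunc.num_algebraMap, h1] at h2
  rw [hf, Polynomial.leadingCoeff_eq_zero.1 h2, map_zero]

/-- The rational function `1 / (z - c)`, and `0` for `c = ∞`: the differential `dz / (z - c)` has
residue `1` at `c` and `-1` at infinity. -/
noncomputable def simplePole : OnePoint ℂ → RatFunc ℂ
  | OnePoint.some c => (algebraMap (Polynomial ℂ) (RatFunc ℂ) (Polynomial.X - Polynomial.C c))⁻¹
  | OnePoint.infty => 0

theorem simplePole_infty : simplePole OnePoint.infty = 0 := rfl

theorem expandAt_simplePole (x : OnePoint ℂ) (c : ℂ) :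
    expandAt x (simplePole c) = (coordAt x - HahnSeries.C c)⁻¹ := by
  change expandAt x (algebraMap (Polynomial ℂ) (RatFunc ℂ) (Polynomial.X - Polynomial.C c))⁻¹ = _
  rw [map_inv₀, expandAt_algebraMap]
  simp

theorem expandAt_simplePole_self (a : ℂ) :
    expandAt (a : OnePoint ℂ) (simplePole a) = HahnSeries.single (-1) 1 := by
  rw [expandAt_simplePole, coordAt_coe, add_sub_cancel_left, HahnSeries.inv_single, inv_one]

theorem expandAt_simplePole_of_ne {a c : ℂ} (hac : a ≠ c) :
    expandAt (a : OnePoint ℂ) (simplePole c) =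
      HahnSeries.ofPowerSeries ℤ ℂ (PowerSeries.C (a - c) + PowerSeries.X)⁻¹ := by
  rw [expandAt_simplePole, coordAt_coe]
  refine inv_eq_of_mul_eq_one_left ?_
  have h1 : HahnSeries.C a + HahnSeries.single 1 1 - HahnSeries.C c =
      HahnSeries.ofPowerSeries ℤ ℂ (PowerSeries.C (a - c) + PowerSeries.X) := by
    rw [map_add, PowerSeries.coe_C, PowerSeries.coe_X, map_sub]
    ring
  rw [h1, ← map_mul, PowerSeries.inv_mul_cancel _ (by simpa using sub_ne_zero.2 hac), map_one]

theorem differentialAt_infty_simplePole (c : ℂ) :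
    differentialAt OnePoint.infty (simplePole c) = HahnSeries.ofPowerSeries ℤ ℂ
      (1 - PowerSeries.C c * PowerSeries.X)⁻¹ * HahnSeries.single (-1) (-1) := by
  have h1 : (HahnSeries.single (-1 : ℤ) (1 : ℂ) : LaurentSeries ℂ) * HahnSeries.single 1 1 = 1 := by
    simp
  have h2 : HahnSeries.ofPowerSeries ℤ ℂ (1 - PowerSeries.C c * PowerSeries.X)⁻¹ *
      HahnSeries.ofPowerSeries ℤ ℂ (1 - PowerSeries.C c * PowerSeries.X) = 1 := by
    rw [← map_mul, PowerSeries.inv_mul_cancel _ (by simp), map_one]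
  have h3 : HahnSeries.ofPowerSeries ℤ ℂ (1 - PowerSeries.C c * PowerSeries.X) =
      1 - HahnSeries.C c * HahnSeries.single 1 1 := by
    rw [map_sub, map_one, map_mul, PowerSeries.coe_C, PowerSeries.coe_X]
  have h4 : (coordAt OnePoint.infty - HahnSeries.C c)⁻¹ = HahnSeries.ofPowerSeries ℤ ℂ
      (1 - PowerSeries.C c * PowerSeries.X)⁻¹ * HahnSeries.single 1 1 := by
    refine inv_eq_of_mul_eq_one_left ?_
    rw [h3] at h2
    rw [coordAt_infty]
    linear_combination h2 + HahnSeries.ofPowerSeries ℤ ℂ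
      (1 - PowerSeries.C c * PowerSeries.X)⁻¹ * h1
  rw [differentialAt_infty, expandAt_simplePole, h4, mul_assoc, HahnSeries.single_mul_single,
    one_mul, show (1 : ℤ) + -2 = -1 by norm_num]

theorem coeff_differentialAt_infty_simplePole (c : ℂ) (n : ℤ) :
    (differentialAt OnePoint.infty (simplePole c)).coeff n = -(HahnSeries.ofPowerSeries ℤ ℂ
      (1 - PowerSeries.C c * PowerSeries.X)⁻¹).coeff (n + 1) := by
  rw [differentialAt_infty_simplePole]
  have := HahnSeries.coeff_mul_single_add (r := (-1 : ℂ)) (x := HahnSeries.ofPowerSeries ℤ ℂ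
    (1 - PowerSeries.C c * PowerSeries.X)⁻¹) (a := n + 1) (b := -1)
  rw [add_neg_cancel_right, mul_neg_one] at this
  rw [this]

/-- A differential `dz / (z - c)` has no poles of order greater than one. -/
theorem coeff_simplePole_of_lt (x c : OnePoint ℂ) {n : ℤ} (hn : n < -1) :
    (differentialAt x (simplePole c)).coeff n = 0 := by
  induction c with
  | infty => simp [simplePole_infty]
  | coe c =>
    induction x with
    | infty =>
      rw [coeff_differentialAt_infty_simplePole, coeff_ofPowerSeries_of_neg _ (by omega), neg_zero]
    | coe a =>
      rw [differentialAt_coe]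
      by_cases hac : a = c
      · rw [hac, expandAt_simplePole_self, HahnSeries.coeff_single_of_ne (by omega)]
      · rw [expandAt_simplePole_of_ne hac, coeff_ofPowerSeries_of_neg _ (by omega)]

open Classical in
theorem residue_simplePole (x c : OnePoint ℂ) :
    (differentialAt x (simplePole c)).coeff (-1) =
      (if c = x then 1 else 0) - if OnePoint.infty = x then 1 else 0 := by
  induction c with
  | infty => simp [simplePole_infty]
  | coe c =>
    induction x with
    | infty =>
      rw [coeff_differentialAt_infty_simplePole, neg_add_cancel, coeff_zero_ofPowerSeries]
      simp
    | coe a =>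
      rw [differentialAt_coe]
      by_cases hac : a = c
      · rw [hac, expandAt_simplePole_self]
        simp
      · rw [expandAt_simplePole_of_ne hac, coeff_ofPowerSeries_of_neg _ (by omega)]
        simp [Ne.symm hac]

theorem coeff_zero_simplePole_of_ne {a c : ℂ} (hac : a ≠ c) :
    (differentialAt (a : OnePoint ℂ) (simplePole c)).coeff 0 = (a - c)⁻¹ := by
  rw [differentialAt_coe, expandAt_simplePole_of_ne hac, coeff_zero_ofPowerSeries]
  simp

theorem coeff_zero_simplePole_infty (c : ℂ) :
    (differentialAt OnePoint.infty (simplePole c)).coeff 0 = -c := by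
  rw [coeff_differentialAt_infty_simplePole, zero_add, PowerSeries.coeff_coe,
    if_neg (by norm_num), Int.natAbs_one]
  have h1 : (1 - PowerSeries.C c * PowerSeries.X) * (1 - PowerSeries.C c * PowerSeries.X)⁻¹ = 1 :=
    PowerSeries.mul_inv_cancel _ (by simp)
  have h2 := congrArg (PowerSeries.coeff 1) h1
  rw [sub_mul, one_mul, map_sub, mul_assoc, PowerSeries.coeff_C_mul, mul_comm PowerSeries.X,
    ← zero_add 1, PowerSeries.coeff_succ_mul_X] at h2
  simp [PowerSeries.coeff_one, sub_eq_zero] at h2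
  rw [h2]

/-- At a point `x` the values of the differentials `dz / (z - c)` with `c ≠ x` are distinct. -/
theorem coeff_zero_simplePole_injective {x c d : OnePoint ℂ} (hc : c ≠ x) (hd : d ≠ x)
    (h : (differentialAt x (simplePole c)).coeff 0 = (differentialAt x (simplePole d)).coeff 0) :
    c = d := by
  induction x with
  | infty =>
    lift c to ℂ using hc
    lift d to ℂ using hd
    rw [coeff_zero_simplePole_infty, coeff_zero_simplePole_infty, neg_inj] at h
    rw [h]
  | coe a =>
    have hne : ∀ b : ℂ, (b : OnePoint ℂ) ≠ a → a ≠ b := fun b hb hab => hb (by rw [hab])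
    induction c with
    | infty =>
      induction d with
      | infty => rfl
      | coe d =>
        rw [coeff_zero_simplePole_of_ne (hne d hd), simplePole_infty, map_zero,
          HahnSeries.coeff_zero] at h
        exact absurd h.symm (inv_ne_zero (sub_ne_zero.2 (hne d hd)))
    | coe c =>
      induction d with
      | infty =>
        rw [coeff_zero_simplePole_of_ne (hne c hc), simplePole_infty, map_zero,
          HahnSeries.coeff_zero] at h
        exact absurd h (inv_ne_zero (sub_ne_zero.2 (hne c hc)))
      | coe d =>
        rw [coeff_zero_simplePole_of_ne (hne c hc), coeff_zero_simplePole_of_ne (hne d hd),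
          inv_inj, sub_right_inj] at h
        rw [h]

/-! ### Canonical sections as flows -/

namespace LargeLimitCurve

variable {V E : Type*} {G : MultiGraph V E} (P : LargeLimitCurve G)

/-- The residues of a family of differentials at the marked points. -/
noncomputable def residue : (V → RatFunc ℂ) →ₗ[ℂ] (E × Bool → ℂ) where
  toFun ω h := (differentialAt (P.pt h) (ω (G.endpt h))).coeff (-1)
  map_add' ω η := by
    ext h
    simp
  map_smul' c ω := by
    ext h
    simp

theorem residue_apply (ω : V → RatFunc ℂ) (h : E × Bool) :
    P.residue ω h = (differentialAt (P.pt h) (ω (G.endpt h))).coeff (-1) := rfl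

theorem residue_flip {ω : V → RatFunc ℂ} (hω : ω ∈ P.canonicalSections) (h : E × Bool) :
    P.residue ω (flip h) = -P.residue ω h := by
  obtain ⟨e, b⟩ := h
  have h1 := hω.2.2 e
  cases b
  · exact eq_neg_of_add_eq_zero_left h1
  · exact eq_neg_of_add_eq_zero_right h1

variable [Fintype E] [DecidableEq V]

/-- The family of the differentials `∑ r h dz / (z - p_h)`, summed over the star of each vertex.
If `r` has sum zero over the star, then the residues at the marked points are `r`, also at
infinity. -/
noncomputable def ofResidues (r : E × Bool → ℂ) (v : V) : RatFunc ℂ :=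
  ∑ h with G.endpt h = v, r h • simplePole (P.pt h)

theorem coeff_ofResidues (r : E × Bool → ℂ) (v : V) (x : OnePoint ℂ) (n : ℤ) :
    (differentialAt x (P.ofResidues r v)).coeff n =
      ∑ h with G.endpt h = v, r h * (differentialAt x (simplePole (P.pt h))).coeff n := by
  simp [ofResidues, map_sum, HahnSeries.coeff_sum]

open Classical in
theorem coeff_neg_one_ofResidues (r : E × Bool → ℂ) (v : V) (x : OnePoint ℂ) :
    (differentialAt x (P.ofResidues r v)).coeff (-1) =
      (∑ h with G.endpt h = v, if P.pt h = x then r h else 0) -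
        if OnePoint.infty = x then G.outflow r v else 0 := by
  rw [coeff_ofResidues, MultiGraph.outflow]
  simp only [residue_simplePole, mul_sub, Finset.sum_sub_distrib, mul_ite, mul_one, mul_zero]
  congr 1
  split_ifs <;> simp

open Classical in
theorem sum_ite_pt_eq (r : E × Bool → ℂ) (h : E × Bool) :
    (∑ k with G.endpt k = G.endpt h, if P.pt k = P.pt h then r k else 0) = r h := by
  rw [Finset.sum_eq_single h]
  · simp
  · intro k hk hne
    rw [Finset.mem_filter] at hk
    exact if_neg fun hp => hne (P.pt_injOn k h hk.2 hp)
  · simp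

open Classical in
theorem sum_ite_pt_eq_zero (r : E × Bool → ℂ) {v : V} {x : OnePoint ℂ} (hx : ¬ P.IsMarked v x) :
    (∑ k with G.endpt k = v, if P.pt k = x then r k else 0) = 0 := by
  refine Finset.sum_eq_zero fun k hk => ?_
  rw [Finset.mem_filter] at hk
  exact if_neg fun hp => hx ⟨k, hk.2, hp⟩

theorem residue_ofResidues {r : E × Bool → ℂ} (hr : r ∈ G.flows) :
    P.residue (P.ofResidues r) = r := by
  classical
  ext h
  rw [residue_apply, coeff_neg_one_ofResidues, hr.2, sum_ite_pt_eq, ite_self, sub_zero]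

theorem ofResidues_mem {r : E × Bool → ℂ} (hr : r ∈ G.flows) :
    P.ofResidues r ∈ P.canonicalSections := by
  classical
  have hlt : ∀ v x, ∀ n : ℤ, n < -1 → (differentialAt x (P.ofResidues r v)).coeff n = 0 := by
    intro v x n hn
    rw [coeff_ofResidues]
    exact Finset.sum_eq_zero fun h _ => by rw [coeff_simplePole_of_lt _ _ hn, mul_zero]
  refine ⟨fun v x hx n hn => ?_, fun v x _ n hn => hlt v x n hn, fun e => ?_⟩
  · rcases (show n < -1 ∨ n = -1 by omega) with hn | rfl
    · exact hlt v x n hn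
    · rw [coeff_neg_one_ofResidues, hr.2, P.sum_ite_pt_eq_zero r hx, ite_self, sub_zero]
  · rw [← residue_apply, ← residue_apply, P.residue_ofResidues hr]
    have h1 : r (e, false) = -r (e, true) := hr.1 (e, true)
    rw [h1, add_neg_cancel]

/-- A canonical section is determined by its residues. -/
theorem eq_ofResidues {ω : V → RatFunc ℂ} (hω : ω ∈ P.canonicalSections) :
    ω = P.ofResidues (P.residue ω) := by
  classical
  have hlt : ∀ v x, ∀ n : ℤ, n < -1 → (differentialAt x (ω v)).coeff n = 0 := by
    intro v x n hn
    by_cases hx : P.IsMarked v x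
    · exact hω.2.1 v x hx n hn
    · exact hω.1 v x hx n (by omega)
  have hlt' : ∀ v x, ∀ n : ℤ, n < -1 →
      (differentialAt x (P.ofResidues (P.residue ω) v)).coeff n = 0 := by
    intro v x n hn
    rw [coeff_ofResidues]
    exact Finset.sum_eq_zero fun h _ => by rw [coeff_simplePole_of_lt _ _ hn, mul_zero]
  ext1 v
  refine sub_eq_zero.1 (eq_zero_of_differentialAt (fun a n hn => ?_) fun n hn => ?_)
  · rw [map_sub, HahnSeries.coeff_sub, sub_eq_zero]
    rcases (show n < -1 ∨ n = -1 by omega) with hn | rfl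
    · rw [hlt v _ n hn, hlt' v _ n hn]
    · rw [coeff_neg_one_ofResidues, if_neg (OnePoint.infty_ne_coe a), sub_zero]
      by_cases hx : P.IsMarked v a
      · obtain ⟨h, rfl, hp⟩ := hx
        rw [← hp, sum_ite_pt_eq, residue_apply]
      · rw [P.sum_ite_pt_eq_zero _ hx, hω.1 v a hx _ (by norm_num)]
  · rw [map_sub, HahnSeries.coeff_sub, hlt v _ n hn, hlt' v _ n hn, sub_zero]

/-- The residue theorem on every sphere. -/
theorem outflow_residue {ω : V → RatFunc ℂ} (hω : ω ∈ P.canonicalSections) (v : V) :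
    G.outflow (P.residue ω) v = 0 := by
  classical
  have h1 := P.coeff_neg_one_ofResidues (P.residue ω) v OnePoint.infty
  rw [← P.eq_ofResidues hω, if_pos rfl] at h1
  by_cases hx : P.IsMarked v OnePoint.infty
  · obtain ⟨h, rfl, hp⟩ := hx
    rw [← hp, sum_ite_pt_eq, ← residue_apply] at h1
    linear_combination h1
  · rw [P.sum_ite_pt_eq_zero _ hx, hω.1 v _ hx _ (by norm_num)] at h1
    simpa using h1

/-- Taking residues identifies the canonical sections with the flows on the graph. -/
noncomputable def sectionsEquivFlows : P.canonicalSections ≃ₗ[ℂ] G.flows where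
  toFun s := ⟨P.residue s.1, P.residue_flip s.2, P.outflow_residue s.2⟩
  map_add' s t := Subtype.ext (map_add P.residue s.1 t.1)
  map_smul' c s := Subtype.ext (map_smul P.residue c s.1)
  invFun r := ⟨P.ofResidues r.1, P.ofResidues_mem r.2⟩
  left_inv s := Subtype.ext (P.eq_ofResidues s.2).symm
  right_inv r := Subtype.ext (P.residue_ofResidues r.2)

theorem residue_symm (r : G.flows) : P.residue (P.sectionsEquivFlows.symm r).1 = r.1 :=
  P.residue_ofResidues r.2

/-- Evaluation of sections at a point, as a linear form. -/
noncomputable def valueLinear {V E : Type*} {G : MultiGraph V E} (P : LargeLimitCurve G)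
    (v : V) (x : OnePoint ℂ) : P.canonicalSections →ₗ[ℂ] ℂ where
  toFun s := P.value s v x
  map_add' s t := by simp [value]
  map_smul' c s := by simp [value]

theorem value_of_isMarked {V E : Type*} {G : MultiGraph V E} (P : LargeLimitCurve G)
    (s : P.canonicalSections) (h : E × Bool) :
    P.value s (G.endpt h) (P.pt h) = P.residue s.1 h := by
  rw [value, if_pos ⟨h, rfl, rfl⟩, residue_apply]

/-- The value at an unmarked point `x` of the differential `dz / (z - p)`, where `p` is the marked
point of `h`; it is zero for `p = ∞`. -/
noncomputable def poleValue {V E : Type*} {G : MultiGraph V E} (P : LargeLimitCurve G)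
    (x : OnePoint ℂ) (h : E × Bool) : ℂ :=
  (differentialAt x (simplePole (P.pt h))).coeff 0

theorem value_of_not_isMarked (s : P.canonicalSections) {v : V} {x : OnePoint ℂ}
    (hx : ¬ P.IsMarked v x) :
    P.value s v x = ∑ h with G.endpt h = v, P.poleValue x h * P.residue s.1 h := by
  rw [value, if_neg hx]
  conv_lhs => rw [P.eq_ofResidues s.2]
  rw [coeff_ofResidues]
  exact Finset.sum_congr rfl fun h _ => mul_comm _ _

theorem poleValue_injOn {V E : Type*} {G : MultiGraph V E} (P : LargeLimitCurve G)
    {v : V} {x : OnePoint ℂ} (hx : ¬ P.IsMarked v x) {h k : E × Bool}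
    (hh : G.endpt h = v) (hk : G.endpt k = v) (heq : P.poleValue x h = P.poleValue x k) :
    h = k :=
  P.pt_injOn h k (hh.trans hk.symm) (coeff_zero_simplePole_injective
    (fun hp => hx ⟨h, hh, hp⟩) (fun hp => hx ⟨k, hk, hp⟩) heq)

/-- The canonical class has no base points. -/
theorem exists_value_ne_zero [Finite V] (hG : G.IsTrivalent) (hth : G.thickness = 3)
    (v : V) (x : OnePoint ℂ) : ∃ s : P.canonicalSections, P.value s v x ≠ 0 := by
  by_contra! hzero
  by_cases hx : P.IsMarked v x
  · obtain ⟨h, rfl, rfl⟩ := hx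
    obtain ⟨a, -, ha, -, ha0, -, hah, -⟩ := G.exists_circulations_meeting_once hth h
    have h1 := hzero (P.sectionsEquivFlows.symm ⟨_, G.intCast_mem_flows ha ha0⟩)
    rw [value_of_isMarked, residue_symm] at h1
    simp [hah] at h1
  obtain ⟨h₁, h₂, h₃, hv₁, hv₂, hv₃, h₁₂, h₁₃, h₂₃, hstar⟩ := hG.exists_star v
  have hval : ∀ r ∈ G.flows,
      P.poleValue x h₁ * r h₁ + P.poleValue x h₂ * r h₂ + P.poleValue x h₃ * r h₃ = 0 := by
    intro r hr
    have h1 := hzero (P.sectionsEquivFlows.symm ⟨r, hr⟩)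
    rwa [P.value_of_not_isMarked _ hx, residue_symm, hstar] at h1
  have hsum : ∀ r ∈ G.flows, r h₁ + r h₂ + r h₃ = 0 := fun r hr => by
    rw [← hstar, ← hr.2 v, MultiGraph.outflow]
  obtain ⟨a, b, ha, hb, ha0, hb0, ha1, hb1, hab⟩ := G.exists_circulations_meeting_once hth h₁
  have hne : h₂.1 ≠ h₁.1 := by
    -- Otherwise the edge of `h₃` would be a bridge.
    intro heq
    obtain ⟨c, -, hc, -, hc0, -, hc1, -⟩ := G.exists_circulations_meeting_once hth h₃
    have h2 := hsum _ (G.intCast_mem_flows hc hc0)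
    have h3 := (eq_or_eq_flip heq).resolve_left h₁₂.symm
    rw [h3, hc, hc1] at h2
    simp at h2
  -- A flow that passes the star through `h₁` and `h₃` only separates their pole values.
  have key : ∀ c : E × Bool → ℤ, (∀ h, c (flip h) = -c h) → (∀ w, G.outflow c w = 0) →
      c h₁ = 1 → c h₂ = 0 → False := by
    intro c hc hc0 hc1 hc2
    have hmem := G.intCast_mem_flows hc hc0
    have h1 := hsum _ hmem
    have h2 := hval _ hmem
    simp only [hc1, hc2, Int.cast_one, Int.cast_zero] at h1 h2
    refine h₁₃ (P.poleValue_injOn hx hv₁ hv₃ ?_)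
    linear_combination h2 - P.poleValue x h₃ * h1
  rcases mul_eq_zero.1 (hab h₂ hne) with h0 | h0
  · exact key a ha ha0 ha1 h0
  · exact key b hb hb0 hb1 h0

end LargeLimitCurve

/-! ### Quadrics through the canonical curve -/

theorem eval_add_smul_of_isHomogeneous_one {g : ℕ} {L : MvPolynomial (Fin g) ℂ}
    (hL : L ∈ MvPolynomial.homogeneousSubmodule (Fin g) ℂ 1) (s t : ℂ) (x y : Fin g → ℂ) :
    MvPolynomial.eval (s • x + t • y) L =
      s * MvPolynomial.eval x L + t * MvPolynomial.eval y L := by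
  rw [MvPolynomial.homogeneousSubmodule_one_eq_span_X] at hL
  induction hL using Submodule.span_induction with
  | mem L hL =>
    obtain ⟨i, rfl⟩ := hL
    simp
  | zero => simp
  | add L M _ _ hL hM =>
    simp only [map_add, hL, hM]
    ring
  | smul c L _ hL =>
    simp only [MvPolynomial.smul_eval, hL]
    ring

/-- The values of a quadratic form on a line are determined by the values at three points. -/
theorem eval_add_smul_of_mem_quadrics {g : ℕ} {Q : MvPolynomial (Fin g) ℂ} (hQ : Q ∈ quadrics g)
    (s t : ℂ) (x y : Fin g → ℂ) :
    MvPolynomial.eval (s • x + t • y) Q =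
      s ^ 2 * MvPolynomial.eval x Q + t ^ 2 * MvPolynomial.eval y Q +
        s * t * (MvPolynomial.eval (x + y) Q - MvPolynomial.eval x Q - MvPolynomial.eval y Q) := by
  replace hQ : Q ∈ MvPolynomial.homogeneousSubmodule (Fin g) ℂ 1 *
      MvPolynomial.homogeneousSubmodule (Fin g) ℂ 1 := by
    rwa [← pow_two, MvPolynomial.homogeneousSubmodule_one_pow]
  induction hQ using Submodule.mul_induction_on' with
  | mem_mul_mem L hL M hM =>
    have hL' := eval_add_smul_of_isHomogeneous_one hL 1 1 x y
    have hM' := eval_add_smul_of_isHomogeneous_one hM 1 1 x y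
    simp only [one_smul, one_mul] at hL' hM'
    simp only [map_mul, eval_add_smul_of_isHomogeneous_one hL s t,
      eval_add_smul_of_isHomogeneous_one hM s t, hL', hM']
    ring
  | add Q _ R _ hQ hR =>
    simp only [map_add, hQ, hR]
    ring

theorem eval_smul_of_mem_quadrics {g : ℕ} {Q : MvPolynomial (Fin g) ℂ} (hQ : Q ∈ quadrics g)
    (s : ℂ) (x : Fin g → ℂ) :
    MvPolynomial.eval (s • x) Q = s ^ 2 * MvPolynomial.eval x Q := by
  simpa using eval_add_smul_of_mem_quadrics hQ s 0 x 0

namespace LargeLimitCurve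

variable {V E : Type*} {G : MultiGraph V E} (P : LargeLimitCurve G) {g : ℕ}
  (b : Module.Basis (Fin g) ℂ P.canonicalSections)

/-- The homogeneous coordinates of the image of the point `x` of `P_v`. -/
noncomputable def coords (v : V) (x : OnePoint ℂ) : Fin g → ℂ := fun i => P.value (b i) v x

/-- The homogeneous coordinates of the node in which the half-edge `h` ends. -/
noncomputable def nodeCoords (h : E × Bool) : Fin g → ℂ := fun i => P.residue (b i).1 h

theorem coords_pt (h : E × Bool) : P.coords b (G.endpt h) (P.pt h) = P.nodeCoords b h :=
  funext fun i => P.value_of_isMarked (b i) h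

theorem nodeCoords_flip (h : E × Bool) : P.nodeCoords b (flip h) = -P.nodeCoords b h :=
  funext fun i => P.residue_flip (b i).2 h

theorem sum_repr_smul_apply (ℓ : P.canonicalSections →ₗ[ℂ] ℂ) (s : P.canonicalSections) :
    ∑ i, b.repr s i * ℓ (b i) = ℓ s := by
  have h := congrArg ℓ (b.sum_repr s)
  simp only [map_sum, map_smul, smul_eq_mul] at h
  exact h

theorem coords_ne_zero [Finite V] [Finite E] (hG : G.IsTrivalent) (hth : G.thickness = 3) (v : V)
    (x : OnePoint ℂ) : P.coords b v x ≠ 0 := by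
  classical
  cases nonempty_fintype E
  obtain ⟨s, hs⟩ := P.exists_value_ne_zero hG hth v x
  intro h0
  refine hs ?_
  change P.valueLinear v x s = 0
  rw [← P.sum_repr_smul_apply b]
  exact Finset.sum_eq_zero fun i _ => mul_eq_zero_of_right _ (congrFun h0 i)

/-- The linear form on the projective space of the canonical map that corresponds to a section. -/
noncomputable def linearForm (s : P.canonicalSections) : MvPolynomial (Fin g) ℂ :=
  ∑ i, b.repr s i • MvPolynomial.X i

theorem linearForm_mem (s : P.canonicalSections) :
    P.linearForm b s ∈ MvPolynomial.homogeneousSubmodule (Fin g) ℂ 1 :=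
  Submodule.sum_mem _ fun i _ => Submodule.smul_mem _ _ (MvPolynomial.isHomogeneous_X ℂ i)

theorem eval_linearForm (s : P.canonicalSections) (h : E × Bool) :
    MvPolynomial.eval (P.nodeCoords b h) (P.linearForm b s) = P.residue s.1 h := by
  have h1 := P.sum_repr_smul_apply b (P.valueLinear (G.endpt h) (P.pt h)) s
  change ∑ i, b.repr s i * P.value (b i) _ _ = P.value s _ _ at h1
  simp only [value_of_isMarked] at h1
  rw [← h1, linearForm, map_sum]
  simp [MvPolynomial.smul_eval, nodeCoords]

/-- The canonical map. -/
noncomputable def canonicalMap (hne : ∀ v x, P.coords b v x ≠ 0) :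
    P.Points → Projectivization ℂ (Fin g → ℂ) :=
  Quot.lift (fun y => Projectivization.mk ℂ (P.coords b y.1 y.2) (hne y.1 y.2)) (by
    rintro _ _ ⟨h, rfl, rfl⟩
    rw [Projectivization.mk_eq_mk_iff']
    refine ⟨-1, ?_⟩
    rw [P.coords_pt b, P.coords_pt b, nodeCoords_flip]
    simp)

theorem isCanonicalMap_canonicalMap (hne : ∀ v x, P.coords b v x ≠ 0) :
    P.IsCanonicalMap b (P.canonicalMap b hne) :=
  fun v x => ⟨hne v x, rfl⟩

theorem mem_quadricsThrough_canonicalMap (hne : ∀ v x, P.coords b v x ≠ 0)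
    {Q : MvPolynomial (Fin g) ℂ} (hQ : Q ∈ quadrics g) :
    Q ∈ quadricsThrough (Set.range (P.canonicalMap b hne)) ↔
      ∀ v x, MvPolynomial.eval (P.coords b v x) Q = 0 := by
  constructor
  · rintro ⟨-, h⟩ v x
    exact h _ (hne v x) ⟨Quot.mk _ (v, x), rfl⟩
  · intro h
    refine ⟨hQ, ?_⟩
    rintro u hu ⟨y, hy⟩
    induction y using Quot.ind with
    | mk y =>
    obtain ⟨c, hc⟩ := (Projectivization.mk_eq_mk_iff' ℂ _ _ hu (hne y.1 y.2)).1 hy.symm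
    rw [← hc, eval_smul_of_mem_quadrics hQ, h, mul_zero]

variable [Fintype E] [DecidableEq V]

theorem coords_of_not_isMarked {v : V} {x : OnePoint ℂ} (hx : ¬ P.IsMarked v x) :
    P.coords b v x = ∑ h with G.endpt h = v, P.poleValue x h • P.nodeCoords b h := by
  ext i
  simp [coords, nodeCoords, P.value_of_not_isMarked _ hx]

theorem sum_nodeCoords (v : V) : ∑ h with G.endpt h = v, P.nodeCoords b h = 0 := by
  ext i
  rw [Finset.sum_apply]
  exact P.outflow_residue (b i).2 v

/-- A quadric contains the canonical curve as soon as it contains the nodes: every component of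
the curve is a line with three nodes on it. -/
theorem eval_coords_eq_zero_iff (hG : G.IsTrivalent) {Q : MvPolynomial (Fin g) ℂ}
    (hQ : Q ∈ quadrics g) : (∀ v x, MvPolynomial.eval (P.coords b v x) Q = 0) ↔
      ∀ e, MvPolynomial.eval (P.nodeCoords b (e, true)) Q = 0 := by
  refine ⟨fun h e => ?_, fun h => ?_⟩
  · rw [← coords_pt]
    exact h _ _
  have hneg : ∀ y, MvPolynomial.eval (-y) Q = MvPolynomial.eval y Q := by
    intro y
    simpa using eval_smul_of_mem_quadrics hQ (-1) y
  have hnode : ∀ k, MvPolynomial.eval (P.nodeCoords b k) Q = 0 := by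
    rintro ⟨e, _ | _⟩
    · rw [← h e, ← hneg, ← nodeCoords_flip]
      rfl
    · exact h e
  intro v x
  by_cases hx : P.IsMarked v x
  · obtain ⟨k, rfl, rfl⟩ := hx
    rw [coords_pt, hnode]
  obtain ⟨h₁, h₂, h₃, -, -, -, -, -, -, hstar⟩ := hG.exists_star v
  have h3 : P.nodeCoords b h₃ = -(P.nodeCoords b h₁ + P.nodeCoords b h₂) := by
    rw [eq_neg_iff_add_eq_zero, add_comm, ← hstar, sum_nodeCoords]
  have h4 : P.coords b v x = (P.poleValue x h₁ - P.poleValue x h₃) • P.nodeCoords b h₁ +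
      (P.poleValue x h₂ - P.poleValue x h₃) • P.nodeCoords b h₂ := by
    rw [P.coords_of_not_isMarked b hx, hstar, h3]
    module
  have h5 : MvPolynomial.eval (P.nodeCoords b h₁ + P.nodeCoords b h₂) Q = 0 := by
    rw [← hneg, ← h3, hnode]
  rw [h4, eval_add_smul_of_mem_quadrics hQ, h5, hnode, hnode]
  ring

/-- The values of quadratic forms at the nodes. -/
noncomputable def evalNodes {V E : Type*} {G : MultiGraph V E} (P : LargeLimitCurve G)
    (b : Module.Basis (Fin g) ℂ P.canonicalSections) : quadrics g →ₗ[ℂ] (E → ℂ) where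
  toFun Q e := MvPolynomial.eval (P.nodeCoords b (e, true)) Q.1
  map_add' Q R := by
    ext e
    simp
  map_smul' c Q := by
    ext e
    simp [MvPolynomial.smul_eval]

/-- The nodes impose independent conditions on quadrics: two flows that meet only in the edge `e`
give a pair of hyperplanes that contains every node except the one of `e`. -/
theorem evalNodes_surjective [Finite V] (hth : G.thickness = 3) :
    Function.Surjective (P.evalNodes b) := by
  classical
  have hsingle : ∀ e, ∃ Q, P.evalNodes b Q = Pi.single e 1 := by
    intro e
    obtain ⟨a, c, ha, hc, ha0, hc0, ha1, hc1, hac⟩ :=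
      G.exists_circulations_meeting_once hth (e, true)
    refine ⟨⟨P.linearForm b (P.sectionsEquivFlows.symm ⟨_, G.intCast_mem_flows ha ha0⟩) *
      P.linearForm b (P.sectionsEquivFlows.symm ⟨_, G.intCast_mem_flows hc hc0⟩),
      MvPolynomial.IsHomogeneous.mul (P.linearForm_mem b _) (P.linearForm_mem b _)⟩, ?_⟩
    ext f
    change MvPolynomial.eval _ (_ * _) = _
    rw [map_mul, eval_linearForm, eval_linearForm, residue_symm, residue_symm]
    by_cases hf : f = e
    · simp [hf, ha1, hc1]
    · rw [Pi.single_eq_of_ne hf]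
      change (a (f, true) : ℂ) * (c (f, true) : ℂ) = 0
      exact_mod_cast hac (f, true) hf
  choose Q hQ using hsingle
  intro y
  refine ⟨∑ e, y e • Q e, ?_⟩
  ext f
  simp [map_sum, hQ, Finset.sum_apply, Pi.single_apply]

theorem ker_evalNodes (hG : G.IsTrivalent) (hne : ∀ v x, P.coords b v x ≠ 0) :
    LinearMap.ker (P.evalNodes b) =
      (quadricsThrough (Set.range (P.canonicalMap b hne))).submoduleOf (quadrics g) := by
  ext Q
  rw [Submodule.submoduleOf, Submodule.mem_comap, Submodule.subtype_apply,
    P.mem_quadricsThrough_canonicalMap b hne Q.2, P.eval_coords_eq_zero_iff b hG Q.2,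
    LinearMap.mem_ker, funext_iff]
  rfl

end LargeLimitCurve

end LargeLimit

theorem proposition30 {V E : Type*} [Finite V] [Finite E] (G : LargeLimit.MultiGraph V E)
    (hG : G.IsTrivalent) (hth : G.thickness = 3) (P : LargeLimit.LargeLimitCurve G) :
    Module.finrank ℂ P.canonicalSections = G.genus ∧
    ∀ b : Module.Basis (Fin G.genus) ℂ P.canonicalSections,
      ∃ φ : P.Points → Projectivization ℂ (Fin G.genus → ℂ),
        P.IsCanonicalMap b φ ∧
        LargeLimit.projDim (LargeLimit.quadricsThrough (Set.range φ)) =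
          LargeLimit.projDim (LargeLimit.quadrics G.genus) - 3 * (G.genus : ℤ) + 3 ∧
        Module.finrank ℂ (LargeLimit.quadrics G.genus ⧸
          (LargeLimit.quadricsThrough (Set.range φ)).submoduleOf
            (LargeLimit.quadrics G.genus)) + 3 = 3 * G.genus := by
  classical
  cases nonempty_fintype V
  cases nonempty_fintype E
  have h1 := G.finrank_flows_add_card (G.connected_of_thickness hth)
  have h2 := hG.two_mul_card_edges
  have h3 : G.genus = Fintype.card E + 1 - Fintype.card V := by
    rw [LargeLimit.MultiGraph.genus, Nat.card_eq_fintype_card, Nat.card_eq_fintype_card]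
  refine ⟨by rw [P.sectionsEquivFlows.finrank_eq]; omega, fun b => ?_⟩
  have hne := P.coords_ne_zero b hG hth
  have hker := P.ker_evalNodes b hG hne
  have hsurj := P.evalNodes_surjective b hth
  have hle : LargeLimit.quadricsThrough (Set.range (P.canonicalMap b hne)) ≤
      LargeLimit.quadrics G.genus := fun _ hQ => hQ.1
  have hfin : FiniteDimensional ℂ (LargeLimit.quadrics G.genus) :=
    Module.Finite.iff_fg.2 (MvPolynomial.homogeneousSubmodule_fg _ _ 2)
  have h4 := ((P.evalNodes b).quotKerEquivOfSurjective hsurj).finrank_eq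
  have h5 := (P.evalNodes b).finrank_range_add_finrank_ker
  rw [hker, Module.finrank_fintype_fun_eq_card] at h4
  rw [LinearMap.range_eq_top.2 hsurj, finrank_top, Module.finrank_fintype_fun_eq_card, hker,
    (Submodule.submoduleOfEquivOfLe hle).finrank_eq] at h5
  refine ⟨P.canonicalMap b hne, P.isCanonicalMap_canonicalMap b hne, ?_, ?_⟩
  · rw [LargeLimit.projDim, LargeLimit.projDim]
    omega
  · rw [h4]
    omega
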